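/- Let $X$ be a connected quasi-projective scheme over $\mathbf{C}$, i.e. a connected $\mathbf{C}$-scheme admitting an immersion over $\mathbf{C}$ into some projective space $\mathbf{P}^n_{\mathbf{C}}$ (no smoothness, reducedness or properness is assumed). Let $D^b(X)$ be the bounded derived category of coherent sheaves on $X$: the localization of the category of bounded complexes of coherent sheaves with respect to the quasi-isomorphisms, with its usual triangulated structure. A thick subcategory of a triangulated category is a full triangulated subcategory closed under direct summands. For full subcategories $\mathcal{K},\mathcal{I}$ of a triangulated category $\mathcal{T}$, write $\mathcal{T}=\langle\mathcal{K},\mathcal{I}\rangle$ if $\mathcal{K}=\mathcal{I}^\perp=\{C\in\mathcal{T} : \operatorname{Hom}(I,C)=0 \text{ for all } I\in\mathcal{I}\}$ and every object $C$ of $\mathcal{T}$ lies in a distinguished triangle $C_1\to C\to C_2\to C_1[1]$ with $C_1\in\mathcal{I}$ and $C_2\in\mathcal{K}$. Let $\mathcal{I}_1,\mathcal{I}_2$ be thick subcategories of $D^b(X)$ such that $D^b(X)=\mathcal{I}_1\oplus\mathcal{I}_2$, meaning that $D^b(X)=\langle\mathcal{I}_1,\mathcal{I}_2\rangle=\langle\mathcal{I}_2,\mathcal{I}_1\rangle$.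 Then $\mathcal{I}_1=0$ or $\mathcal{I}_2=0$; that is, all objects of $\mathcal{I}_1$ are zero objects or all objects of $\mathcal{I}_2$ are zero objects. -/

import Mathlib

open CategoryTheory CategoryTheory.Limits CategoryTheory.Pretriangulated AlgebraicGeometry
open scoped ZeroObject

noncomputable section

universe u

/-! ### Bounded complexes and the bounded homotopy category of an additive category -/

section Bounded

variable (C : Type*) [Category* C] [Preadditive C]

/-- The property of being a bounded cochain complex: `K i = 0` for `i < a` and for `i > b`. -/
def boundedComplex : ObjectProperty (CochainComplex C ℤ) :=
  fun K ↦ (∃ a : ℤ, K.IsStrictlyGE a) ∧ ∃ b : ℤ, K.IsStrictlyLE b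

/-- The category of bounded cochain complexes and morphisms of complexes. -/
abbrev BoundedComplex := (boundedComplex C).FullSubcategory

/-- The objects of the homotopy category whose underlying complex is bounded. -/
def boundedHtpy : ObjectProperty (HomotopyCategory C (.up ℤ)) :=
  (boundedComplex C).strictMap (HomotopyCategory.quotient _ _)

/-- The homotopy category of bounded complexes. -/
abbrev BoundedHtpy := (boundedHtpy C).FullSubcategory

variable {C} in
@[simp]
lemma boundedHtpy_quotient_obj_iff (K : CochainComplex C ℤ) :
    boundedHtpy C ((HomotopyCategory.quotient _ _).obj K) ↔ boundedComplex C K := by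
  refine ⟨?_, fun h ↦ ⟨_, h⟩⟩
  simp only [boundedHtpy, ObjectProperty.strictMap_iff]
  rintro ⟨L, h, hL⟩
  obtain rfl : L = K := congr_arg Quotient.as hL
  exact h

/-- The projection from bounded complexes to the bounded homotopy category. -/
def boundedQuotient : BoundedComplex C ⥤ BoundedHtpy C :=
  ObjectProperty.lift _
    ((boundedComplex C).ι ⋙ HomotopyCategory.quotient C (.up ℤ)) (by
      rintro ⟨K, h⟩
      simpa [boundedHtpy_quotient_obj_iff])

variable {C} in
lemma boundedQuotient_obj_surjective : Function.Surjective (boundedQuotient C).obj :=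
  fun K ↦ by
    obtain ⟨L, hL⟩ := HomotopyCategory.quotient_obj_surjective K.obj
    refine ⟨⟨L, ?_⟩, by ext; exact hL⟩
    rw [← boundedHtpy_quotient_obj_iff, hL]
    exact K.property

instance : (boundedQuotient C).EssSurj where
  mem_essImage K := by
    obtain ⟨L, rfl⟩ := boundedQuotient_obj_surjective K
    exact ⟨L, ⟨Iso.refl _⟩⟩

instance : (boundedQuotient C).Full := by dsimp [boundedQuotient]; infer_instance

variable [HasBinaryBiproducts C]

variable {C} in
lemma boundedComplex_mappingCone {K L : CochainComplex C ℤ} (f : K ⟶ L)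
    (hK : boundedComplex C K) (hL : boundedComplex C L) :
    boundedComplex C (CochainComplex.mappingCone f) := by
  obtain ⟨⟨a, _⟩, b, _⟩ := hK
  obtain ⟨⟨a', _⟩, b', _⟩ := hL
  refine ⟨⟨min (a - 1) a', CochainComplex.isStrictlyGE_mappingCone f a a' _ (by simp) (by simp)⟩,
    max b b', ?_⟩
  rw [CochainComplex.isStrictlyLE_iff]
  intro i hi
  simp only [CochainComplex.mappingCone.isZero_X_iff]
  exact ⟨K.isZero_of_isStrictlyLE b _ (by lia), L.isZero_of_isStrictlyLE b' _ (by lia)⟩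

open HomologicalComplex in
variable {C} in
lemma boundedComplex_cylinder (K : CochainComplex C ℤ) (hK : boundedComplex C K) :
    boundedComplex C (cylinder K) := by
  obtain ⟨⟨a, _⟩, b, _⟩ := hK
  have aux (i : ℤ) (h₁ : IsZero (K.X i)) (h₂ : IsZero (K.X (i + 1))) :
      IsZero ((cylinder K).X i) := by
    dsimp [cylinder]
    refine homotopyCofiber.isZero_X _ _ ?_ (fun j hj ↦ ?_)
    · refine IsZero.of_iso ?_ ((HomologicalComplex.eval C (.up ℤ) i).mapBiprod _ _)
      simpa using h₁
    · obtain rfl : i + 1 = j := by simpa using hj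
      exact h₂
  refine ⟨⟨a - 1, ?_⟩, b, ?_⟩
  · rw [CochainComplex.isStrictlyGE_iff]
    exact fun i hi ↦ aux i (K.isZero_of_isStrictlyGE a _) (K.isZero_of_isStrictlyGE a _)
  · rw [CochainComplex.isStrictlyLE_iff]
    exact fun i hi ↦ aux i (K.isZero_of_isStrictlyLE b _) (K.isZero_of_isStrictlyLE b _)

variable [HasZeroObject C]

instance : (boundedHtpy C).ContainsZero where
  exists_zero :=
    ⟨(HomotopyCategory.quotient _ _).obj 0, Functor.map_isZero _ (isZero_zero _), by
      simp only [boundedHtpy_quotient_obj_iff]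
      exact ⟨⟨0, inferInstance⟩, 0, inferInstance⟩⟩

instance : (boundedHtpy C).IsStableUnderShift ℤ where
  isStableUnderShiftBy n :=
    { le_shift K hK := by
        obtain ⟨K : CochainComplex _ _, rfl⟩ := K.quotient_obj_surjective
        simp only [boundedHtpy_quotient_obj_iff] at hK
        obtain ⟨⟨a, _⟩, b, _⟩ := hK
        rw [ObjectProperty.prop_shift_iff, HomotopyCategory.shift_quotient_obj,
          boundedHtpy_quotient_obj_iff]
        exact ⟨⟨a - n, K.isStrictlyGE_shift a n (a - n) (by lia)⟩,
          b - n, K.isStrictlyLE_shift b n (b - n) (by lia)⟩ }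

instance : (boundedHtpy C).IsTriangulatedClosed₃ where
  ext₃' T hT h₁ h₂ := by
    have h₁' : boundedComplex C T.obj₁.as := by rwa [← boundedHtpy_quotient_obj_iff]
    have h₂' : boundedComplex C T.obj₂.as := by rwa [← boundedHtpy_quotient_obj_iff]
    obtain ⟨f : T.obj₁.as ⟶ T.obj₂.as, hf⟩ :=
      (HomotopyCategory.quotient _ _).map_surjective T.mor₁
    refine ⟨_, ?_, ⟨Triangle.π₃.mapIso (isoTriangleOfIso₁₂ T _ hT
      (HomotopyCategory.mappingCone_triangleh_distinguished f) (Iso.refl _) (Iso.refl _) ?_)⟩⟩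
    · exact (boundedHtpy_quotient_obj_iff _).2 (boundedComplex_mappingCone f h₁' h₂')
    · exact (Category.comp_id _).trans (hf.symm.trans (Category.id_comp _).symm)

instance : (boundedHtpy C).IsTriangulated where
  toIsTriangulatedClosed₂ := .of_isTriangulatedClosed₃

open HomologicalComplex HomotopicalAlgebra in
instance : (boundedQuotient C).IsLocalization
    ((homotopyEquivalences C (.up ℤ)).inverseImage (boundedComplex C).ι) :=
  Functor.isLocalization_of_essSurj_of_full_of_exists_cylinders _ _
    (fun _ _ f hf ↦ by
      simpa [← isIso_iff_of_reflects_iso _ (boundedHtpy C).ι,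
        ← HomotopyCategory.inverseImage_quotient_isomorphisms] using! hf) (by
    rintro K L f₀ f₁ hf
    obtain ⟨f₀, rfl⟩ := ObjectProperty.homMk_surjective f₀
    obtain ⟨f₁, rfl⟩ := ObjectProperty.homMk_surjective f₁
    replace hf := HomotopyCategory.homotopyOfEq f₀ f₁ ((boundedHtpy C).ι.congr_map hf)
    exact ⟨K.obj.precylinder.toFullSubcategory (boundedComplex_cylinder _ K.property),
      Precylinder.LeftHomotopy.fullSubcategoryEquiv.symm
      { h := cylinder.desc _ _ hf
        h₀ := cylinder.ι₀_desc _ _ hf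
        h₁ := cylinder.ι₁_desc _ _ hf }, ⟨cylinder.homotopyEquiv _ (fun n ↦ ⟨n - 1, by simp⟩), rfl⟩⟩)

end Bounded

/-! ### Coherent sheaves -/

/-- Coherence of an `𝒪_X`-module `F` (for `X` locally noetherian): on every affine open
`U = Spec A`, the restriction of `F` is the sheaf `M^~` of a finitely generated `A`-module `M`. -/
def isCoherent (X : Scheme.{u}) : ObjectProperty X.Modules := fun F ↦
  ∀ (U : X.Opens) (hU : IsAffineOpen U), ∃ M : ModuleCat.{u} Γ(X, U),
    Module.Finite Γ(X, U) M ∧ Nonempty (F.restrict hU.fromSpec ≅ tilde M)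

/-- The category of coherent sheaves on `X`. -/
abbrev Coh (X : Scheme.{u}) := (isCoherent X).FullSubcategory

variable (X : Scheme.{u})

instance : (isCoherent X).IsClosedUnderIsomorphisms where
  of_iso e h U hU := by
    obtain ⟨M, hM, ⟨e'⟩⟩ := h U hU
    exact ⟨M, hM, ⟨(Scheme.Modules.restrictFunctor hU.fromSpec).mapIso e.symm ≪≫ e'⟩⟩

instance : (isCoherent X).ContainsZero where
  exists_zero := by
    refine ⟨0, isZero_zero _, fun U hU ↦ ⟨ModuleCat.of _ PUnit, inferInstance, ⟨?_⟩⟩⟩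
    have : IsZero (ModuleCat.of Γ(X, U) PUnit.{u + 1}) := ModuleCat.isZero_of_subsingleton _
    exact (Functor.map_isZero (Scheme.Modules.restrictFunctor hU.fromSpec)
      (isZero_zero X.Modules)).iso ((tilde.functor Γ(X, U)).map_isZero this)

instance : (isCoherent X).IsClosedUnderBinaryProducts where
  limitsOfShape_le := by
    rintro F ⟨p⟩ U hU
    obtain ⟨M₁, _, ⟨e₁⟩⟩ := p.prop_diag_obj ⟨.left⟩ U hU
    obtain ⟨M₂, _, ⟨e₂⟩⟩ := p.prop_diag_obj ⟨.right⟩ U hU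
    have := preservesBinaryBiproducts_of_preservesBinaryCoproducts
      (Scheme.Modules.restrictFunctor hU.fromSpec)
    have := preservesBinaryBiproducts_of_preservesBinaryCoproducts (tilde.functor Γ(X, U))
    let e : F ≅ p.diag.obj ⟨.left⟩ ⊞ p.diag.obj ⟨.right⟩ :=
      p.isLimit.conePointUniqueUpToIso
        ((IsLimit.postcomposeHomEquiv (diagramIsoPair p.diag).symm _).symm
          (BinaryBiproduct.isLimit (p.diag.obj ⟨.left⟩) (p.diag.obj ⟨.right⟩)))
    refine ⟨M₁ ⊞ M₂, Module.Finite.equiv (ModuleCat.biprodIsoProd M₁ M₂).symm.toLinearEquiv, ⟨?_⟩⟩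
    exact (Scheme.Modules.restrictFunctor hU.fromSpec).mapIso e ≪≫
      (Scheme.Modules.restrictFunctor hU.fromSpec).mapBiprod _ _ ≪≫ biprod.mapIso e₁ e₂ ≪≫
      ((tilde.functor Γ(X, U)).mapBiprod M₁ M₂).symm

instance : (isCoherent X).IsClosedUnderFiniteProducts := .mk'

instance : HasBinaryBiproducts (Coh X) := HasBinaryBiproducts.of_hasBinaryProducts

/-! ### The bounded derived category of coherent sheaves -/

/-- The quasi-isomorphisms of bounded complexes of coherent sheaves, i.e. the morphisms
which induce isomorphisms on all cohomology sheaves. -/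
def cohQuasiIso : MorphismProperty (BoundedComplex (Coh X)) :=
  (HomologicalComplex.quasiIso X.Modules (.up ℤ)).inverseImage
    ((boundedComplex (Coh X)).ι ⋙ (isCoherent X).ι.mapHomologicalComplex (.up ℤ))

/-- The bounded derived category of `X`: the localization of the category of bounded complexes
of coherent sheaves with respect to quasi-isomorphisms. -/
def Db := (cohQuasiIso X).Localization

namespace Db

instance : Category (Db X) := inferInstanceAs (Category (cohQuasiIso X).Localization)

/-- The localization functor. -/
def Q : BoundedComplex (Coh X) ⥤ Db X := (cohQuasiIso X).Q

instance : (Q X).IsLocalization (cohQuasiIso X) :=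
  inferInstanceAs ((cohQuasiIso X).Q.IsLocalization (cohQuasiIso X))

lemma homotopyEquivalences_le_cohQuasiIso :
    (HomologicalComplex.homotopyEquivalences (Coh X) (.up ℤ)).inverseImage
      (boundedComplex (Coh X)).ι ≤ cohQuasiIso X := by
  rintro K L f ⟨e, he⟩
  refine homotopyEquivalences_le_quasiIso X.Modules _ _
    ⟨(isCoherent X).ι.mapHomotopyEquiv e, ?_⟩
  exact congr_arg ((isCoherent X).ι.mapHomologicalComplex (.up ℤ)).map he

/-- The functor from the bounded homotopy category of coherent sheaves to the homotopy category of
`𝒪_X`-modules. -/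
abbrev htpyToModules : BoundedHtpy (Coh X) ⥤ HomotopyCategory X.Modules (.up ℤ) :=
  (boundedHtpy (Coh X)).ι ⋙ (isCoherent X).ι.mapHomotopyCategory (.up ℤ)

/-- The acyclic bounded complexes of coherent sheaves, in the homotopy category. -/
abbrev acyclic : ObjectProperty (BoundedHtpy (Coh X)) :=
  (HomotopyCategory.subcategoryAcyclic X.Modules).inverseImage (htpyToModules X)

/-- The functor from the bounded homotopy category to the derived category. -/
def Qh : BoundedHtpy (Coh X) ⥤ Db X :=
  Localization.lift (Q X)
    (MorphismProperty.IsInvertedBy.of_le _ _ _ (Localization.inverts (Q X) (cohQuasiIso X))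
      (homotopyEquivalences_le_cohQuasiIso X)) (boundedQuotient (Coh X))

/-- `Qh` extends `Q`. -/
def quotientCompQhIso : boundedQuotient (Coh X) ⋙ Qh X ≅ Q X :=
  Localization.fac _ _ _

instance : (boundedQuotient (Coh X) ⋙ Qh X).IsLocalization (cohQuasiIso X) :=
  Functor.IsLocalization.of_iso _ (quotientCompQhIso X).symm

lemma quasiIso_inverseImage_eq_trW :
    (HomotopyCategory.quasiIso X.Modules (.up ℤ)).inverseImage (htpyToModules X) =
      (acyclic X).trW := by
  ext K L f
  obtain ⟨M, g, h, mem⟩ := distinguished_cocone_triangle f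
  have := (HomotopyCategory.subcategoryAcyclic X.Modules).trW_iff_of_distinguished _
    ((htpyToModules X).map_distinguished _ mem)
  rw [← HomotopyCategory.quasiIso_eq_trW_subcategoryAcyclic] at this
  exact this.trans ((acyclic X).trW_iff_of_distinguished _ mem).symm

lemma boundedQuotient_map_mem_iff {K L : BoundedComplex (Coh X)} (f : K ⟶ L) :
    (acyclic X).trW ((boundedQuotient (Coh X)).map f) ↔ cohQuasiIso X f := by
  rw [← quasiIso_inverseImage_eq_trW]
  exact HomotopyCategory.quotient_map_mem_quasiIso_iff
    (((isCoherent X).ι.mapHomologicalComplex (.up ℤ)).map f.hom)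

lemma trW_eq_map : (acyclic X).trW = (cohQuasiIso X).map (boundedQuotient (Coh X)) := by
  ext K L f
  obtain ⟨K, rfl⟩ := boundedQuotient_obj_surjective K
  obtain ⟨L, rfl⟩ := boundedQuotient_obj_surjective L
  obtain ⟨f, rfl⟩ := (boundedQuotient (Coh X)).map_surjective f
  constructor
  · intro hf
    rw [boundedQuotient_map_mem_iff] at hf
    exact MorphismProperty.map_mem_map _ _ _ hf
  · rintro ⟨K', L', g, h, ⟨e⟩⟩
    rw [← boundedQuotient_map_mem_iff] at h
    exact ((acyclic X).trW.arrow_mk_iso_iff e).1 h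

instance : (Qh X).IsLocalization (acyclic X).trW :=
  Functor.IsLocalization.of_comp (boundedQuotient (Coh X)) (Qh X)
    ((HomologicalComplex.homotopyEquivalences (Coh X) (.up ℤ)).inverseImage
      (boundedComplex (Coh X)).ι) (acyclic X).trW (cohQuasiIso X)
    (homotopyEquivalences_le_cohQuasiIso X) (trW_eq_map X)

/-! The triangulated structure: the shift is the shift of complexes, and the distinguished
triangles are those isomorphic to images of mapping cone triangles. -/

instance : Preadditive (Db X) := Localization.preadditive (Qh X) (acyclic X).trW

instance : (Qh X).Additive := Localization.functor_additive (Qh X) (acyclic X).trW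

instance : HasZeroObject (Db X) := (Qh X).hasZeroObject_of_additive

instance : HasShift (Db X) ℤ := HasShift.localized (Qh X) (acyclic X).trW ℤ

instance : (Qh X).CommShift ℤ := Functor.CommShift.localized (Qh X) (acyclic X).trW ℤ

instance (n : ℤ) : (shiftFunctor (Db X) n).Additive := by
  rw [Localization.functor_additive_iff (Qh X) (acyclic X).trW]
  exact Functor.additive_of_iso ((Qh X).commShiftIso n)

instance : Pretriangulated (Db X) :=
  Triangulated.Localization.pretriangulated (Qh X) (acyclic X).trW

instance : (Qh X).IsTriangulated :=
  Triangulated.Localization.isTriangulated_functor (Qh X) (acyclic X).trW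

instance : IsTriangulated (Db X) :=
  Triangulated.Localization.isTriangulated (Qh X) (acyclic X).trW

end Db

/-! ### Semi-orthogonal decompositions -/

/-- `T = ⟨K, I⟩` is a semi-orthogonal decomposition: `K` is the right orthogonal of `I`, and every
object `C` sits in a distinguished triangle `C₁ ⟶ C ⟶ C₂ ⟶ C₁⟦1⟧` with `C₁ ∈ I`, `C₂ ∈ K`. -/
structure IsSemiorthogonalDecomposition {T : Type*} [Category* T] [Preadditive T]
    [HasZeroObject T] [HasShift T ℤ] [∀ n : ℤ, (shiftFunctor T n).Additive] [Pretriangulated T]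
    (K I : ObjectProperty T) : Prop where
  eq_rightOrthogonal : K = I.rightOrthogonal
  exists_triangle (C : T) : ∃ (C₁ C₂ : T) (f : C₁ ⟶ C) (g : C ⟶ C₂) (h : C₂ ⟶ C₁⟦(1 : ℤ)⟧),
    I C₁ ∧ K C₂ ∧ Triangle.mk f g h ∈ distTriang T

/-! ### Quasi-projective complex schemes -/

section

attribute [local instance] MvPolynomial.gradedAlgebra

/-- Projective space `ℙⁿ` over `ℂ`. -/
def ProjectiveSpaceC (n : ℕ) : Scheme.{0} :=
  Proj (MvPolynomial.homogeneousSubmodule (Fin (n + 1)) ℂ)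

/-- The structure morphism `ℙⁿ ⟶ Spec ℂ`. -/
def ProjectiveSpaceC.toSpec (n : ℕ) : ProjectiveSpaceC n ⟶ Spec (.of ℂ) :=
  Proj.toSpecZero (MvPolynomial.homogeneousSubmodule (Fin (n + 1)) ℂ) ≫
    Spec.map (CommRingCat.ofHom
      (algebraMap ℂ (MvPolynomial.homogeneousSubmodule (Fin (n + 1)) ℂ 0)))

end

/-- A scheme `X` over `Spec ℂ` is quasi-projective if it admits an immersion
(a closed immersion into an open subscheme) into some `ℙⁿ` over `Spec ℂ`. -/
def IsQuasiProjective {X : Scheme.{0}} (f : X ⟶ Spec (.of ℂ)) : Prop :=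
  ∃ (n : ℕ) (i : X ⟶ ProjectiveSpaceC n), IsImmersion i ∧ i ≫ ProjectiveSpaceC.toSpec n = f

end

/-!
Why a connected quasi-projective scheme `X` over `ℂ` has an indecomposable bounded derived
category. Since the two summands are orthogonal on both sides, every object `C` is a direct sum
`C₁ ⊞ C₂` with `C₁ ∈ I₁` and `C₂ ∈ I₂`. The decomposition of a coherent sheaf `F` is controlled by
an idempotent of the sheaf `F` itself: the projector to `C₂` induces an idempotent endomorphism of
`ℋ⁰(F) = F`, and `C₂ = 0` as soon as this idempotent vanishes
(`Db.isZero_of_sheafEnd_eq_zero`), because the cohomology sheaves jointly detect zero objects.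

* Idempotents of `𝒪_X` are idempotent functions, so by connectedness `𝒪_X` lies in `I₁` or in `I₂`;
  say in `I₁` (`Db.structureModule_mem_or_mem`).
* A skyscraper sheaf at a closed point is a quotient of `𝒪_X`. Its projector to `I₂` is killed by
  the surjection from `𝒪_X`, hence vanishes, and the skyscraper sheaf lies in `I₁`
  (`Db.skyscraperModule_mem`).
* A nonzero idempotent of a coherent sheaf is detected by a morphism to a skyscraper sheaf
  (`exists_skyscraperModule_comp_ne_zero`), whereas there are no nonzero morphisms from `I₂` to
  `I₁`. Hence all coherent sheaves lie in `I₁` (`Db.single_mem`).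
* Bounded complexes are successive extensions of shifts of coherent sheaves (`Db.devissage`), so
  `I₁` is everything and `I₂ = 0`.

Quasi-projectivity enters only in that `X` is locally of finite type over `ℂ`, hence Jacobson:
closed points of affine opens are closed in `X`, which makes the skyscraper sheaves coherent.
-/

noncomputable section

universe u

section Cohomology

variable (X : Scheme.{u})

/-! ### Cohomology sheaves on the bounded derived category -/

namespace Db

lemma isInvertedBy_homologyFunctor (i : ℤ) :
    (acyclic X).trW.IsInvertedBy
      (htpyToModules X ⋙ HomotopyCategory.homologyFunctor X.Modules (.up ℤ) i) := by
  intro K L f hf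
  rw [← quasiIso_inverseImage_eq_trW] at hf
  exact (HomotopyCategory.mem_quasiIso_iff _).1 hf i

/-- The cohomology sheaf functor `ℋⁱ` on the bounded derived category. -/
def cohomology (i : ℤ) : Db X ⥤ X.Modules :=
  Localization.lift _ (isInvertedBy_homologyFunctor X i) (Qh X)

/-- `ℋⁱ` on the derived category is induced by cohomology on the homotopy category. -/
def QhCompCohomologyIso (i : ℤ) :
    Qh X ⋙ cohomology X i ≅
      htpyToModules X ⋙ HomotopyCategory.homologyFunctor X.Modules (.up ℤ) i :=
  Localization.fac _ _ _

instance (i : ℤ) : (cohomology X i).Additive := by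
  rw [Localization.functor_additive_iff (Qh X) (acyclic X).trW]
  exact Functor.additive_of_iso (QhCompCohomologyIso X i).symm

/-- The value of `ℋⁱ` on the image of a bounded complex is its usual cohomology sheaf. -/
def boundedQuotientCompQhCompCohomologyIso (i : ℤ) :
    boundedQuotient (Coh X) ⋙ Qh X ⋙ cohomology X i ≅
      (boundedComplex (Coh X)).ι ⋙ (isCoherent X).ι.mapHomologicalComplex (.up ℤ) ⋙
        HomologicalComplex.homologyFunctor X.Modules (.up ℤ) i :=
  Functor.isoWhiskerLeft _ (QhCompCohomologyIso X i) ≪≫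
    Functor.isoWhiskerLeft ((boundedComplex (Coh X)).ι ⋙
      (isCoherent X).ι.mapHomologicalComplex (.up ℤ))
      (HomotopyCategory.homologyFunctorFactors X.Modules (.up ℤ) i)

lemma exists_iso_Qh_obj (C : Db X) :
    ∃ K : BoundedComplex (Coh X), Nonempty (C ≅ (Qh X).obj ((boundedQuotient (Coh X)).obj K)) := by
  have := Localization.essSurj (boundedQuotient (Coh X) ⋙ Qh X) (cohQuasiIso X)
  exact ⟨_, ⟨((boundedQuotient (Coh X) ⋙ Qh X).objObjPreimageIso C).symm⟩⟩

variable {X} in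
/-- An object of the derived category vanishes as soon as all its cohomology sheaves do. -/
lemma isZero_of_isZero_cohomology {C : Db X} (h : ∀ i, IsZero ((cohomology X i).obj C)) :
    IsZero C := by
  obtain ⟨K, ⟨e⟩⟩ := exists_iso_Qh_obj X C
  refine IsZero.of_iso ?_ e
  have hK (i : ℤ) := (h i).of_iso (((boundedQuotientCompQhCompCohomologyIso X i).app K).symm ≪≫
    (cohomology X i).mapIso e.symm)
  -- The morphism from the zero complex to `K` is a quasi-isomorphism.
  let Z : BoundedComplex (Coh X) := ⟨0, ⟨0, inferInstance⟩, 0, inferInstance⟩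
  have hZ : IsZero ((boundedComplex (Coh X)).ι.obj Z) := isZero_zero _
  have hZ' : IsZero ((boundedQuotient (Coh X)).obj Z) := by
    rw [IsZero.iff_id_eq_zero]
    ext
    exact ((HomotopyCategory.quotient _ _).map_isZero hZ).eq_of_src _ _
  let f : Z ⟶ K := ObjectProperty.homMk 0
  have hf : cohQuasiIso X f := by
    change HomologicalComplex.quasiIso _ _ _
    rw [HomologicalComplex.mem_quasiIso_iff, quasiIso_iff]
    intro i
    rw [quasiIsoAt_iff_isIso_homologyMap]
    have h₁ := (HomologicalComplex.homologyFunctor X.Modules (.up ℤ) i).map_isZero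
      (((isCoherent X).ι.mapHomologicalComplex (.up ℤ)).map_isZero hZ)
    exact ⟨0, h₁.eq_of_src _ _, (hK i).eq_of_src _ _⟩
  have := Localization.inverts (boundedQuotient (Coh X) ⋙ Qh X) (cohQuasiIso X) f hf
  exact ((Qh X).map_isZero hZ').of_iso
    (asIso ((boundedQuotient (Coh X) ⋙ Qh X).map f)).symm

/-! ### Coherent sheaves as objects of the derived category -/

/-- A coherent sheaf as a bounded complex concentrated in degree `n`. -/
def boundedSingle (n : ℤ) : Coh X ⥤ BoundedComplex (Coh X) :=
  ObjectProperty.lift _ (HomologicalComplex.single (Coh X) (.up ℤ) n)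
    fun _ ↦ ⟨⟨n, inferInstance⟩, n, inferInstance⟩

/-- The functor sending a coherent sheaf `F` to `F[-n]` in the bounded derived category. -/
def single (n : ℤ) : Coh X ⥤ Db X := boundedSingle X n ⋙ boundedQuotient (Coh X) ⋙ Qh X

/-- `ℋⁱ(F[-n])` is the cohomology in degree `i` of the complex of `𝒪_X`-modules with the single
term `F` in degree `n`. -/
def singleCompCohomologyIso' (n i : ℤ) :
    single X n ⋙ cohomology X i ≅ (isCoherent X).ι ⋙
      HomologicalComplex.single X.Modules (.up ℤ) n ⋙
        HomologicalComplex.homologyFunctor X.Modules (.up ℤ) i :=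
  Functor.isoWhiskerLeft (boundedSingle X n) (boundedQuotientCompQhCompCohomologyIso X i) ≪≫
    Functor.isoWhiskerRight
      (HomologicalComplex.singleMapHomologicalComplex (isCoherent X).ι (.up ℤ) n)
      (HomologicalComplex.homologyFunctor X.Modules (.up ℤ) i)

/-- `ℋⁿ(F[-n]) = F`. -/
def singleCompCohomologyIso (n : ℤ) : single X n ⋙ cohomology X n ≅ (isCoherent X).ι :=
  singleCompCohomologyIso' X n n ≪≫ Functor.isoWhiskerLeft (isCoherent X).ι
    (HomologicalComplex.homologyFunctorSingleIso X.Modules (.up ℤ) n)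

variable {X} in
lemma isZero_cohomology_single (F : Coh X) {n i : ℤ} (h : i ≠ n) :
    IsZero ((cohomology X i).obj ((single X n).obj F)) :=
  (HomologicalComplex.isZero_single_obj_homology (.up ℤ) n F.obj i h).of_iso
    ((singleCompCohomologyIso' X n i).app F)

variable {X} in
/-- `F[-n]` is the shift by `-n` of `F` placed in degree zero. -/
lemma nonempty_single_iso_shift (F : Coh X) (n : ℤ) :
    Nonempty ((single X n).obj F ≅ ((single X 0).obj F)⟦-n⟧) := by
  let e : (HomologicalComplex.single (Coh X) (.up ℤ) 0).obj F⟦-n⟧ ≅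
      (HomologicalComplex.single (Coh X) (.up ℤ) n).obj F :=
    ((CochainComplex.singleFunctors (Coh X)).shiftIso (-n) n 0 (by lia)).app F
  let e' : ((boundedHtpy (Coh X)).ι.obj
        ((boundedQuotient (Coh X)).obj ((boundedSingle X 0).obj F)))⟦-n⟧ ≅
      (boundedHtpy (Coh X)).ι.obj ((boundedQuotient (Coh X)).obj ((boundedSingle X n).obj F)) :=
    (((HomotopyCategory.quotient (Coh X) (.up ℤ)).commShiftIso (-n)).app _).symm ≪≫
      (HomotopyCategory.quotient (Coh X) (.up ℤ)).mapIso e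
  let e'' := (boundedHtpy (Coh X)).fullyFaithfulι.preimageIso
    (((boundedHtpy (Coh X)).ι.commShiftIso (-n)).app _ ≪≫ e')
  exact ⟨(Qh X).mapIso e''.symm ≪≫ ((Qh X).commShiftIso (-n)).app _⟩

end Db

end Cohomology

section Devissage

/-! ### Dévissage of bounded complexes -/

section BruteTruncation

variable {C : Type*} [Category* C] [Preadditive C] [HasZeroObject C]

open Classical in
/-- The object `A` if `p` holds, and zero otherwise. -/
def zeroUnless (p : Prop) (A : C) : C := if p then A else 0

namespace zeroUnless

variable (p : Prop) (A : C)

omit [Preadditive C] in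
lemma isZero {p : Prop} (h : ¬ p) : IsZero (zeroUnless p A) := by
  rw [zeroUnless, if_neg h]
  exact isZero_zero C

open Classical in
/-- The projection of `A` to `zeroUnless p A`. -/
def π : A ⟶ zeroUnless p A := if h : p then eqToHom (if_pos h).symm else 0

open Classical in
/-- The inclusion of `zeroUnless p A` in `A`. -/
def ι : zeroUnless p A ⟶ A := if h : p then eqToHom (if_pos h) else 0

variable {p} in
lemma π_ι (h : p) : π p A ≫ ι p A = 𝟙 A := by
  rw [π, ι, dif_pos h, dif_pos h]
  exact eqToHom_trans _ _

variable {p} in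
lemma π_eq_zero (h : ¬ p) : π p A = 0 := dif_neg h

variable {p} in
lemma ι_eq_zero (h : ¬ p) : ι p A = 0 := dif_neg h

lemma ι_π : ι p A ≫ π p A = 𝟙 _ := by
  by_cases h : p
  · rw [π, ι, dif_pos h, dif_pos h]
    exact eqToHom_trans _ _
  · exact (isZero A h).eq_of_src _ _

lemma ι_π_not : ι p A ≫ π (¬ p) A = 0 := by
  by_cases h : p
  · rw [π_eq_zero _ (not_not.2 h), comp_zero]
  · rw [ι_eq_zero _ h, zero_comp]

lemma π_ι_add_π_ι_not : π p A ≫ ι p A + π (¬ p) A ≫ ι (¬ p) A = 𝟙 A := by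
  by_cases h : p
  · rw [π_eq_zero _ (not_not.2 h), zero_comp, π_ι _ h, add_zero]
  · rw [π_eq_zero _ h, zero_comp, π_ι _ h, zero_add]

end zeroUnless

namespace CochainComplex

variable (K : CochainComplex C ℤ) (p : ℤ → Prop)

/-- The terms of the complex `K` in the degrees satisfying `p`, with the differentials of `K`
between consecutive such degrees. -/
def bruteTruncation : CochainComplex C ℤ where
  X n := zeroUnless (p n) (K.X n)
  d i j := zeroUnless.ι _ _ ≫ K.d i j ≫ zeroUnless.π _ _
  shape i j h := by rw [K.shape i j h, zero_comp, comp_zero]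
  d_comp_d' i j k _ _ := by
    by_cases h : p j
    · simp only [Category.assoc]
      rw [reassoc_of% zeroUnless.π_ι (K.X j) h]
      simp
    · exact (zeroUnless.isZero _ h).eq_zero_of_tgt _ =≫ _ |>.trans zero_comp

/-- The inclusion of the truncation to the degrees `≥ b` in `K`. -/
def bruteTruncationι (b : ℤ) : K.bruteTruncation (b ≤ ·) ⟶ K where
  f n := zeroUnless.ι _ _
  comm' i j hij := by
    change _ = (zeroUnless.ι _ _ ≫ K.d i j ≫ zeroUnless.π _ _) ≫ _
    obtain rfl : i + 1 = j := hij
    by_cases h : b ≤ i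
    · rw [Category.assoc, Category.assoc, zeroUnless.π_ι _ (by lia), Category.comp_id]
      rfl
    · exact (zeroUnless.isZero _ h).eq_of_src _ _

/-- The projection of `K` to its truncation to the degrees `< b`. -/
def bruteTruncationπ (b : ℤ) : K ⟶ K.bruteTruncation (¬ b ≤ ·) where
  f n := zeroUnless.π _ _
  comm' i j hij := by
    change _ ≫ (zeroUnless.ι _ _ ≫ K.d i j ≫ zeroUnless.π _ _) = _
    obtain rfl : i + 1 = j := hij
    by_cases h : b ≤ i
    · exact (zeroUnless.isZero _ (by lia)).eq_of_tgt _ _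
    · rw [reassoc_of% zeroUnless.π_ι (K.X i) h]
      rfl

/-- The brute truncations of a complex `K` form a degreewise split short exact sequence. -/
@[simps]
def bruteTruncationShortComplex (b : ℤ) : ShortComplex (CochainComplex C ℤ) where
  f := K.bruteTruncationι b
  g := K.bruteTruncationπ b
  zero := by
    ext n
    exact zeroUnless.ι_π_not _ _

/-- The degreewise splitting of the short exact sequence of brute truncations. -/
def bruteTruncationSplitting (b n : ℤ) :
    ((K.bruteTruncationShortComplex b).map (HomologicalComplex.eval C _ n)).Splitting where
  r := zeroUnless.π _ _
  s := zeroUnless.ι _ _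
  f_r := zeroUnless.ι_π _ _
  s_g := zeroUnless.ι_π _ _
  id := zeroUnless.π_ι_add_π_ι_not _ _

lemma isStrictlyGE_bruteTruncation (a : ℤ) (h : ∀ i < a, p i → IsZero (K.X i)) :
    (K.bruteTruncation p).IsStrictlyGE a := by
  rw [isStrictlyGE_iff]
  intro i hi
  by_cases hp : p i
  · exact (h i hi hp).of_iso ⟨zeroUnless.ι _ _, zeroUnless.π _ _, zeroUnless.ι_π _ _,
      zeroUnless.π_ι _ hp⟩
  · exact zeroUnless.isZero _ hp

lemma isStrictlyLE_bruteTruncation (b : ℤ) (h : ∀ i > b, p i → IsZero (K.X i)) :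
    (K.bruteTruncation p).IsStrictlyLE b := by
  rw [isStrictlyLE_iff]
  intro i hi
  by_cases hp : p i
  · exact (h i hi hp).of_iso ⟨zeroUnless.ι _ _, zeroUnless.π _ _, zeroUnless.ι_π _ _,
      zeroUnless.π_ι _ hp⟩
  · exact zeroUnless.isZero _ hp

end CochainComplex

variable [HasBinaryBiproducts C]

/-- A triangulated property of objects of the bounded homotopy category which holds for complexes
concentrated in a single degree holds for all bounded complexes. -/
lemma boundedHtpy_devissage (P : ObjectProperty (BoundedHtpy C)) [P.IsTriangulated]
    [P.IsClosedUnderIsomorphisms]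
    (hP : ∀ (K : BoundedComplex C) (n : ℤ), K.obj.IsStrictlyGE n → K.obj.IsStrictlyLE n →
      P ((boundedQuotient C).obj K)) (K : BoundedComplex C) :
    P ((boundedQuotient C).obj K) := by
  suffices ∀ (n : ℕ) (a : ℤ) (K : BoundedComplex C), K.obj.IsStrictlyGE a →
      K.obj.IsStrictlyLE (a + n) → P ((boundedQuotient C).obj K) by
    obtain ⟨⟨a, _⟩, b, _⟩ := K.property
    exact this (b - a).toNat a K inferInstance (K.obj.isStrictlyLE_of_le b _ (by lia))
  intro n
  -- Split off the top term of a complex with `n + 2` terms.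
  induction n with
  | zero => exact fun a K h₁ h₂ ↦ hP K a h₁ (by simpa using h₂)
  | succ n hn =>
    intro a K h₁ h₂
    let b := a + (n + 1)
    have : K.obj.IsStrictlyLE b := by simpa [b] using h₂
    have g₁ := K.obj.isStrictlyGE_bruteTruncation (b ≤ ·) b (by lia)
    have l₁ := K.obj.isStrictlyLE_bruteTruncation (b ≤ ·) b
      (fun i hi _ ↦ K.obj.isZero_of_isStrictlyLE b i hi)
    have g₃ := K.obj.isStrictlyGE_bruteTruncation (¬ b ≤ ·) a
      (fun i hi _ ↦ K.obj.isZero_of_isStrictlyGE a i hi)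
    have l₃ := K.obj.isStrictlyLE_bruteTruncation (¬ b ≤ ·) (a + n) (by lia)
    let K₁ : BoundedComplex C := ⟨_, ⟨b, g₁⟩, b, l₁⟩
    let K₃ : BoundedComplex C := ⟨_, ⟨a, g₃⟩, _, l₃⟩
    have h₁ := hP K₁ b g₁ l₁
    have h₃ := hn a K₃ g₃ l₃
    let f : K₁ ⟶ K := ObjectProperty.homMk (K.obj.bruteTruncationι b)
    obtain ⟨Z, g, h, mem⟩ := distinguished_cocone_triangle ((boundedQuotient C).map f)
    have mem' := (boundedHtpy C).ι.map_distinguished _ mem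
    have mem'' := (HomotopyCategory.distinguished_iff_iso_trianglehOfDegreewiseSplit _).2
      ⟨_, K.obj.bruteTruncationSplitting b, ⟨Iso.refl _⟩⟩
    -- The cone of the inclusion of the top term is the truncation below it.
    let e := isoTriangleOfIso₁₂ _ _ mem' mem'' (Iso.refl _) (Iso.refl _)
      ((Category.comp_id _).trans (Category.id_comp _).symm)
    let e' : Z ≅ (boundedQuotient C).obj K₃ :=
      (boundedHtpy C).fullyFaithfulι.preimageIso (Triangle.π₃.mapIso e)
    exact P.ext_of_isTriangulatedClosed₂ _ mem h₁ (P.prop_of_iso e'.symm h₃)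

end BruteTruncation

namespace Db

variable {X : Scheme.{u}}

/-- A triangulated property of objects of the derived category which holds for coherent sheaves
holds for all objects. -/
lemma devissage (P : ObjectProperty (Db X)) [P.IsTriangulated] [P.IsClosedUnderIsomorphisms]
    (hP : ∀ F : Coh X, P ((single X 0).obj F)) (C : Db X) : P C := by
  obtain ⟨K, ⟨e⟩⟩ := exists_iso_Qh_obj X C
  refine P.prop_of_iso e.symm ?_
  refine boundedHtpy_devissage (P.inverseImage (Qh X)) (fun K n _ _ ↦ ?_) K
  obtain ⟨F, ⟨e⟩⟩ := K.obj.exists_iso_single n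
  let e' : K ≅ (boundedSingle X n).obj F :=
    (boundedComplex (Coh X)).fullyFaithfulι.preimageIso e
  obtain ⟨e''⟩ := nonempty_single_iso_shift F n
  exact P.prop_of_iso (((boundedQuotient _ ⋙ Qh X).mapIso e') ≪≫ e'').symm
    (P.le_shift (-n) _ (hP F))

end Db

end Devissage

section Sheaves

/-! ### The structure sheaf -/

variable (X : Scheme.{u})

/-- The structure sheaf `𝒪_X` as a module over itself. -/
abbrev structureModule : X.Modules := SheafOfModules.unit X.ringCatSheaf

lemma isCoherent_structureModule : isCoherent X (structureModule X) := fun _ hU ↦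
  ⟨ModuleCat.of _ _, inferInstanceAs (Module.Finite _ _),
    ⟨Scheme.Modules.restrictUnitIso hU.fromSpec⟩⟩

variable {X}

/-- The global section `1` of `𝒪_X`. -/
def structureModule.one : Γ(structureModule X, ⊤) := (1 : Γ(X, ⊤))

/-- The structure sheaf is generated by its global section `1`. -/
lemma structureModule.hom_ext {M : X.Modules} {e e' : structureModule X ⟶ M}
    (h : e.app ⊤ structureModule.one = e'.app ⊤ structureModule.one) : e = e' := by
  refine Scheme.Modules.hom_ext _ _ fun U ↦ ?_
  ext x
  let i : U ⟶ (⊤ : X.Opens) := homOfLE le_top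
  let y : Γ(X, U) := x
  have hx : x = y • (structureModule X).presheaf.map i.op structureModule.one := by
    change y = y * X.presheaf.map i.op 1
    rw [map_one, mul_one]
  have key (e : structureModule X ⟶ M) :
      e.app U x = y • M.presheaf.map i.op (e.app ⊤ structureModule.one) := by
    rw [hx, Scheme.Modules.Hom.app_smul]
    congr 1
    exact congr($(e.mapPresheaf.naturality i.op) structureModule.one)
  rw [key, key, h]

/-- The ring of functions on a connected scheme has no nontrivial idempotents. -/
lemma eq_zero_or_eq_one_of_mul_self_eq [ConnectedSpace X] {a : Γ(X, ⊤)} (h : a * a = a) :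
    a = 0 ∨ a = 1 := by
  have hab : a * (1 - a) = 0 := by rw [mul_sub, mul_one, h, sub_self]
  -- The loci where `a` and `1 - a` are invertible are complementary, as the stalks are local.
  have hcompl : ((X.basicOpen a : X.Opens) : Set X)ᶜ = X.basicOpen (1 - a) := by
    ext x
    simp only [Set.mem_compl_iff, SetLike.mem_coe, Scheme.mem_basicOpen_top]
    constructor
    · intro hx
      refine (IsLocalRing.isUnit_or_isUnit_of_add_one ?_).resolve_left hx
      rw [← map_add, add_sub_cancel, map_one]
    · intro h₁ h₂
      exact (h₂.mul h₁).ne_zero (by rw [← map_mul, hab, map_zero])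
  have hclopen : IsClopen ((X.basicOpen a : X.Opens) : Set X) :=
    ⟨⟨by rw [hcompl]; exact (X.basicOpen _).isOpen⟩, (X.basicOpen a).isOpen⟩
  have isUnit_of {f : Γ(X, ⊤)} (hf : ((X.basicOpen f : X.Opens) : Set X) = Set.univ) :
      IsUnit f := by
    refine RingedSpace.isUnit_of_isUnit_germ _ _ _ fun x hx ↦ ?_
    have hxf : x ∈ (X.basicOpen f : Set X) := hf.symm ▸ Set.mem_univ x
    exact (Scheme.mem_basicOpen_top _ _ _).1 hxf
  rcases isClopen_iff.1 hclopen with h0 | h1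
  · left
    rw [h0, Set.compl_empty] at hcompl
    exact (isUnit_of hcompl.symm).mul_left_eq_zero.1 hab
  · right
    exact (sub_eq_zero.1 ((isUnit_of h1).mul_right_eq_zero.1 hab)).symm

/-- The structure sheaf of a connected scheme is indecomposable. -/
lemma structureModule.eq_zero_or_eq_id [ConnectedSpace X]
    {e : structureModule X ⟶ structureModule X} (h : e ≫ e = e) : e = 0 ∨ e = 𝟙 _ := by
  let a : Γ(X, ⊤) := e.app ⊤ one
  have ha : a * a = a := by
    have h₁ : e.app ⊤ (e.app ⊤ one) = e.app ⊤ one :=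
      congr(Scheme.Modules.Hom.app $h ⊤ one)
    have h₂ : e.app ⊤ one = a • (one : Γ(structureModule X, ⊤)) := (mul_one a).symm
    rw [h₂, Scheme.Modules.Hom.app_smul, h₂] at h₁
    change a * (a * 1) = a * 1 at h₁
    simpa using h₁
  refine (eq_zero_or_eq_one_of_mul_self_eq ha).imp (fun h ↦ hom_ext ?_) (fun h ↦ hom_ext ?_)
  · exact h
  · exact h

/-! ### Direct images of `𝒪`-modules -/

open Scheme.Modules

/-- The direct image of `M^~` under `Spec S ⟶ Spec R` is the sheaf associated with `M` regarded
as an `R`-module. -/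
def pushforwardTildeIso {R S : CommRingCat.{u}} (φ : R ⟶ S) (M : ModuleCat.{u} S) :
    (pushforward (Spec.map φ)).obj (tilde M) ≅
      tilde ((ModuleCat.restrictScalars φ.hom).obj M) :=
  have : IsIso (fromTildeΓ (tilde M)) := inferInstance
  have := isIso_fromTildeΓ_pushforward φ (tilde M)
  (asIso (fromTildeΓ ((pushforward (Spec.map φ)).obj (tilde M)))).symm ≪≫
    (tilde.functor R).mapIso
      ((TopCat.Sheaf.forget _ _ ⋙ (evaluation _ _).obj (.op ⊤)).mapIso
          ((pushforwardCompModulesSpecToSheafIso φ).app (tilde M)) ≪≫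
        (ModuleCat.restrictScalars φ.hom).mapIso (tilde.isoTop M).symm)

/-! ### Skyscraper sheaves -/

/-- A direct image restricts to zero on every open which is disjoint from the image. -/
lemma isZero_restrict_pushforward {Y Z : Scheme.{u}} (j : Z ⟶ X) (M : Z.Modules) (f : Y ⟶ X)
    [IsOpenImmersion f] (h : Disjoint (Set.range j) (Set.range f)) :
    IsZero (((pushforward j).obj M).restrict f) := by
  rw [IsZero.iff_id_eq_zero]
  refine Scheme.Modules.hom_ext _ _ fun W ↦ ?_
  have hW : j ⁻¹ᵁ (f ''ᵁ W) = ⊥ := by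
    ext z
    simp only [TopologicalSpace.Opens.coe_bot, Set.mem_empty_iff_false, iff_false]
    rintro ⟨y, -, hy⟩
    exact Set.disjoint_left.1 h ⟨z, rfl⟩ ⟨y, hy⟩
  have : IsZero (M.presheaf.obj (.op (j ⁻¹ᵁ (f ''ᵁ W)))) := by
    rw [hW]
    exact (TopCat.Sheaf.isTerminalOfEmpty ⟨M.presheaf, M.isSheaf⟩).isZero
  exact this.eq_of_src _ _

/-- On a Jacobson scheme, a morphism locally of finite type from a reduced one-point affine scheme
is finite over every affine open it meets, so the direct image of the structure sheaf is
coherent. -/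
lemma isCoherent_pushforward_tilde_of_subsingleton [JacobsonSpace X] {K : CommRingCat.{u}}
    [Subsingleton (Spec K)] [IsReduced (Spec K)] (j : Spec K ⟶ X) [LocallyOfFiniteType j] :
    isCoherent X ((pushforward j).obj (tilde (ModuleCat.of K K))) := by
  intro V hV
  -- If the point lies in `V`, it is a finite morphism to `V`; otherwise the restriction is zero.
  by_cases h : Set.range j ⊆ Set.range hV.fromSpec
  · let k : Spec K ⟶ Spec Γ(X, V) := IsOpenImmersion.lift hV.fromSpec j h
    have hk : k ≫ hV.fromSpec = j := IsOpenImmersion.lift_fac _ _ _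
    have : LocallyOfFiniteType (k ≫ hV.fromSpec) := hk ▸ inferInstance
    have : LocallyOfFiniteType k := locallyOfFiniteType_of_comp k hV.fromSpec
    have : JacobsonSpace (Spec Γ(X, V)) := .of_isOpenEmbedding hV.fromSpec.isOpenEmbedding
    have : IsFinite k := isFinite_iff_locallyOfFiniteType_of_jacobsonSpace.2 inferInstance
    obtain ⟨φ, hφ⟩ := Spec.map_surjective k
    have hfin : φ.hom.Finite := (IsFinite.SpecMap_iff φ).1 (hφ ▸ inferInstance)
    refine ⟨(ModuleCat.restrictScalars φ.hom).obj (.of K K), hfin, ⟨?_⟩⟩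
    exact (restrictFunctor hV.fromSpec).mapIso ((pushforwardCongr (hφ ▸ hk.symm)).app _ ≪≫
        ((pushforwardComp (Spec.map φ) hV.fromSpec).app _).symm) ≪≫
      (restrictFunctorAdjCounitIso hV.fromSpec).app _ ≪≫ pushforwardTildeIso φ _
  · refine ⟨ModuleCat.of _ PUnit, inferInstance, ⟨?_⟩⟩
    refine (isZero_restrict_pushforward _ _ _ ?_).iso
      ((tilde.functor _).map_isZero (ModuleCat.isZero_of_subsingleton _))
    rw [Set.disjoint_left]
    rintro _ ⟨z, rfl⟩ hz
    refine h ?_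
    rintro _ ⟨z', rfl⟩
    rwa [Subsingleton.elim z' z]

/-- The adjunct of an epimorphism `p` need not be epi, but a morphism in the image of the right
adjoint which it kills vanishes. -/
lemma eq_zero_of_homEquiv_comp_map_eq_zero {C D : Type*} [Category* C] [Category* D]
    [Preadditive C] [Preadditive D] {L : C ⥤ D} {R : D ⥤ C} [R.Additive] (adj : L ⊣ R)
    {A : C} {B B' : D} (p : L.obj A ⟶ B) [Epi p] (e : B ⟶ B')
    (h : adj.homEquiv _ _ p ≫ R.map e = 0) : e = 0 := by
  rw [← cancel_epi p, comp_zero]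
  apply (adj.homEquiv _ _).injective
  rw [adj.homEquiv_naturality_right, h, Adjunction.homEquiv_unit, R.map_zero, comp_zero]

lemma map_comp_eq_zero_of_comp_homEquiv_eq_zero {C D : Type*} [Category* C] [Category* D]
    [Preadditive C] [Preadditive D] {L : C ⥤ D} {R : D ⥤ C} [R.Additive] (adj : L ⊣ R)
    {A A' : C} {B : D} (e : A' ⟶ A) (q : L.obj A ⟶ B)
    (h : e ≫ adj.homEquiv _ _ q = 0) : L.map e ≫ q = 0 := by
  apply (adj.homEquiv _ _).injective
  rw [adj.homEquiv_naturality_left, h, Adjunction.homEquiv_unit, R.map_zero, comp_zero]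

/-- The functor `M ↦ M^~`, with values in the modules over `Spec R` for a bundled ring `R`. -/
def tildeFunctor (R : CommRingCat.{u}) : ModuleCat.{u} R ⥤ (Spec R).Modules := tilde.functor R

instance (R : CommRingCat.{u}) : (tildeFunctor R).Full := inferInstanceAs (tilde.functor R).Full

instance (R : CommRingCat.{u}) : (tildeFunctor R).Faithful :=
  inferInstanceAs (tilde.functor R).Faithful

instance (R : CommRingCat.{u}) : (tildeFunctor R).Additive :=
  inferInstanceAs (tilde.functor R).Additive

instance (R : CommRingCat.{u}) : (tildeFunctor R).IsLeftAdjoint :=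
  inferInstanceAs (tilde.functor R).IsLeftAdjoint

/-- The skyscraper sheaf with value the residue field `Γ(X, U) ⧸ m` at the closed point of the
affine open `U` given by the maximal ideal `m`. -/
def skyscraperModule {U : X.Opens} (hU : IsAffineOpen U) (m : Ideal Γ(X, U)) : X.Modules :=
  (pushforward hU.fromSpec).obj ((tildeFunctor _).obj (ModuleCat.of Γ(X, U) (Γ(X, U) ⧸ m)))

lemma isCoherent_skyscraperModule [JacobsonSpace X] {U : X.Opens} (hU : IsAffineOpen U)
    (m : Ideal Γ(X, U)) [m.IsMaximal] : isCoherent X (skyscraperModule hU m) := by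
  let K : CommRingCat.{u} := .of (Γ(X, U) ⧸ m)
  let : Field K := Ideal.Quotient.field m
  let π : Γ(X, U) ⟶ K := CommRingCat.ofHom (Ideal.Quotient.mk m)
  have : IsDomain K := inferInstanceAs (IsDomain (Γ(X, U) ⧸ m))
  have : Subsingleton (Spec K) := inferInstanceAs (Subsingleton (PrimeSpectrum (Γ(X, U) ⧸ m)))
  have : IsClosedImmersion (Spec.map π) :=
    IsClosedImmersion.spec_of_surjective _ Ideal.Quotient.mk_surjective
  refine (isCoherent X).prop_of_iso ?_
    (isCoherent_pushforward_tilde_of_subsingleton (K := K) (Spec.map π ≫ hU.fromSpec))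
  exact ((pushforwardComp (Spec.map π) hU.fromSpec).app _).symm ≪≫
    (pushforward hU.fromSpec).mapIso (pushforwardTildeIso π _)

/-- The structure sheaf restricts to the structure sheaf on an affine open. -/
def structureModuleRestrictIso {U : X.Opens} (hU : IsAffineOpen U) :
    (structureModule X).restrict hU.fromSpec ≅
      (tildeFunctor _).obj (ModuleCat.of Γ(X, U) Γ(X, U)) :=
  restrictUnitIso hU.fromSpec

/-- The projection from the structure sheaf to a skyscraper sheaf. -/
def toSkyscraperModule {U : X.Opens} (hU : IsAffineOpen U) (m : Ideal Γ(X, U)) :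
    structureModule X ⟶ skyscraperModule hU m :=
  (restrictAdjunction hU.fromSpec).homEquiv _ _
    ((structureModuleRestrictIso hU).hom ≫
      (tildeFunctor _).map (ModuleCat.ofHom (Submodule.mkQ m)))

/-- The structure sheaf generates its skyscraper quotients, so that an endomorphism of a skyscraper
sheaf killed by the projection from the structure sheaf vanishes. -/
lemma eq_zero_of_toSkyscraperModule_comp {U : X.Opens} (hU : IsAffineOpen U) (m : Ideal Γ(X, U))
    {e : skyscraperModule hU m ⟶ skyscraperModule hU m} (h : toSkyscraperModule hU m ≫ e = 0) :
    e = 0 := by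
  obtain ⟨e, rfl⟩ := (pushforward hU.fromSpec).map_surjective e
  have : Epi (ModuleCat.ofHom (Submodule.mkQ m)) :=
    (ModuleCat.epi_iff_surjective _).2 (Submodule.mkQ_surjective m)
  rw [eq_zero_of_homEquiv_comp_map_eq_zero (restrictAdjunction hU.fromSpec) _ e h,
    Functor.map_zero]
  rfl

/-- A morphism of `𝒪_X`-modules vanishes if it does so on all affine opens. -/
lemma eq_zero_of_restrict_eq_zero {F G : X.Modules} (e : F ⟶ G)
    (h : ∀ (U : X.Opens) (hU : IsAffineOpen U), (restrictFunctor hU.fromSpec).map e = 0) :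
    e = 0 := by
  have h' (U : X.Opens) (hU : IsAffineOpen U) : e.app U = 0 := by
    have key (W : X.Opens) (hW : hU.fromSpec ''ᵁ ⊤ = W) : e.app W = 0 := by
      subst hW
      exact congr(Scheme.Modules.Hom.app $(h U hU) ⊤)
    exact key U (by simp)
  refine Scheme.Modules.hom_ext _ _ fun W ↦ ?_
  ext s
  refine TopCat.Sheaf.eq_of_locally_eq' ⟨G.presheaf, G.isSheaf⟩
    (fun U : {U : X.affineOpens // U.1 ≤ W} ↦ U.1.1) W (fun U ↦ homOfLE U.2) ?_ _ _ ?_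
  · intro x hx
    obtain ⟨U, hU, hxU, hUW⟩ :=
      TopologicalSpace.Opens.isBasis_iff_nbhd.1 X.isBasis_affineOpens hx
    exact TopologicalSpace.Opens.mem_iSup.2 ⟨⟨⟨U, hU⟩, hUW⟩, hxU⟩
  · intro U
    have := congr($(e.mapPresheaf.naturality (homOfLE U.2).op) s)
    refine this.symm.trans ?_
    change e.app U.1.1 _ = _
    rw [h' _ U.1.2]
    exact (map_zero (G.presheaf.map _).hom).symm

/-- A nonzero idempotent endomorphism of a finite module is detected by a simple quotient. -/
lemma exists_linearMap_comp_ne_zero {A M : Type*} [CommRing A] [AddCommGroup M] [Module A M]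
    [Module.Finite A M] {e : M →ₗ[A] M} (he : e ∘ₗ e = e) (h0 : e ≠ 0) :
    ∃ (m : Ideal A) (_ : m.IsMaximal) (φ : M →ₗ[A] A ⧸ m), φ ∘ₗ e ≠ 0 := by
  -- A simple quotient of the finite module `range e`, precomposed with the projection to it.
  have : Nontrivial (LinearMap.range e) := by
    rwa [Submodule.nontrivial_iff_ne_bot, Ne, LinearMap.range_eq_bot]
  obtain ⟨P, hP⟩ := IsCoatomic.exists_coatom (Submodule A (LinearMap.range e))
  have : IsSimpleModule A (LinearMap.range e ⧸ P) := isSimpleModule_iff_isCoatom.2 hP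
  obtain ⟨m, hm, ⟨f⟩⟩ := isSimpleModule_iff_quot_maximal.1 this
  refine ⟨m, hm, f.toLinearMap ∘ₗ P.mkQ ∘ₗ e.rangeRestrict, fun h ↦ hP.1 ?_⟩
  rw [eq_top_iff]
  rintro ⟨_, x, rfl⟩ -
  have h₁ : f (P.mkQ (e.rangeRestrict (e x))) = 0 := congr($h x)
  rw [map_eq_zero_iff _ f.injective, Submodule.mkQ_apply, Submodule.Quotient.mk_eq_zero] at h₁
  convert h₁ using 1
  exact Subtype.ext (congr($he x)).symm

/-- A nonzero idempotent endomorphism of a coherent sheaf is detected by a morphism to a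
skyscraper sheaf. -/
lemma exists_skyscraperModule_comp_ne_zero {F : X.Modules} (hF : isCoherent X F) {e : F ⟶ F}
    (he : e ≫ e = e) (h0 : e ≠ 0) :
    ∃ (U : X.Opens) (hU : IsAffineOpen U) (m : Ideal Γ(X, U)) (_ : m.IsMaximal)
      (v : F ⟶ skyscraperModule hU m), e ≫ v ≠ 0 := by
  obtain ⟨U, hU, hne⟩ : ∃ (U : X.Opens) (hU : IsAffineOpen U),
      (restrictFunctor hU.fromSpec).map e ≠ 0 := by
    by_contra! h
    exact h0 (eq_zero_of_restrict_eq_zero e h)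
  obtain ⟨M, _, ⟨i'⟩⟩ := hF U hU
  let i : F.restrict hU.fromSpec ≅ (tildeFunctor _).obj M := i'
  obtain ⟨e', he'⟩ := (tildeFunctor _).map_surjective
    (i.inv ≫ (restrictFunctor hU.fromSpec).map e ≫ i.hom)
  have hidem : e' ≫ e' = e' := by
    apply (tildeFunctor _).map_injective
    rw [Functor.map_comp, he']
    simp only [Category.assoc, Iso.hom_inv_id_assoc, ← Functor.map_comp_assoc, he]
  have hne' : e'.hom ≠ 0 := by
    intro h
    have : e' = 0 := ModuleCat.hom_ext h
    rw [this, Functor.map_zero] at he'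
    refine hne ?_
    rw [← cancel_epi i.inv, ← cancel_mono i.hom, Category.assoc, ← he']
    simp
  obtain ⟨m, hm, φ, hφ⟩ := exists_linearMap_comp_ne_zero (congr(($hidem).hom)) hne'
  refine ⟨U, hU, m, hm, (restrictAdjunction hU.fromSpec).homEquiv _ _
    (i.hom ≫ (tildeFunctor _).map (ModuleCat.ofHom φ)), fun h ↦ hφ ?_⟩
  have h₁ := map_comp_eq_zero_of_comp_homEquiv_eq_zero (restrictAdjunction hU.fromSpec) _ _ h
  have h₂ : e' ≫ ModuleCat.ofHom φ = 0 := by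
    apply (tildeFunctor _).map_injective
    rw [Functor.map_comp, he', Category.assoc, Category.assoc, h₁, comp_zero, Functor.map_zero]
  exact congr(($h₂).hom)

end Sheaves

section Decomposition

/-! ### Orthogonal decompositions -/

/-- Two semi-orthogonal decompositions `T = ⟨I₁, I₂⟩ = ⟨I₂, I₁⟩` split every object as a direct
sum of an object of `I₁` and an object of `I₂`. -/
lemma IsSemiorthogonalDecomposition.exists_splitting {T : Type*} [Category* T] [Preadditive T]
    [HasZeroObject T] [HasShift T ℤ] [∀ n : ℤ, (shiftFunctor T n).Additive] [Pretriangulated T]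
    {I₁ I₂ : ObjectProperty T} [I₁.IsStableUnderShift ℤ]
    (h₁₂ : IsSemiorthogonalDecomposition I₁ I₂) (h₂₁ : IsSemiorthogonalDecomposition I₂ I₁)
    (C : T) : ∃ (C₁ C₂ : T) (i₁ : C₁ ⟶ C) (p₁ : C ⟶ C₁) (i₂ : C₂ ⟶ C) (p₂ : C ⟶ C₂),
      I₁ C₁ ∧ I₂ C₂ ∧ i₁ ≫ p₁ = 𝟙 _ ∧ i₂ ≫ p₂ = 𝟙 _ ∧ p₁ ≫ i₁ + p₂ ≫ i₂ = 𝟙 C := by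
  obtain ⟨C₁, C₂, f, g, h, hC₁, hC₂, mem⟩ := h₂₁.exists_triangle C
  have h0 : h = 0 := by
    have := h₁₂.eq_rightOrthogonal ▸ I₁.le_shift (1 : ℤ) _ hC₁
    exact this h hC₂
  obtain ⟨e : C ≅ C₁ ⊞ C₂, -⟩ := exists_iso_binaryBiproduct_of_distTriang _ mem h0
  refine ⟨C₁, C₂, biprod.inl ≫ e.inv, e.hom ≫ biprod.fst, biprod.inr ≫ e.inv,
    e.hom ≫ biprod.snd, hC₁, hC₂, by simp, by simp, ?_⟩
  have : e.hom ≫ (biprod.fst ≫ biprod.inl + biprod.snd ≫ biprod.inr) ≫ e.inv = 𝟙 C := by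
    rw [biprod.total, Category.id_comp, e.hom_inv_id]
  simpa only [Preadditive.add_comp, Preadditive.comp_add, Category.assoc] using this

namespace Db

variable {X : Scheme.{u}}

/-- The endomorphism of a coherent sheaf induced by an endomorphism in the derived category. -/
def sheafEnd {F : Coh X} (φ : (single X 0).obj F ⟶ (single X 0).obj F) : F.obj ⟶ F.obj :=
  (singleCompCohomologyIso X 0).inv.app F ≫ (cohomology X 0).map φ ≫
    (singleCompCohomologyIso X 0).hom.app F

lemma sheafEnd_comp {F : Coh X} (φ ψ : (single X 0).obj F ⟶ (single X 0).obj F) :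
    sheafEnd (φ ≫ ψ) = sheafEnd φ ≫ sheafEnd ψ := by
  simp [sheafEnd]

lemma sheafEnd_add {F : Coh X} (φ ψ : (single X 0).obj F ⟶ (single X 0).obj F) :
    sheafEnd (φ + ψ) = sheafEnd φ + sheafEnd ψ := by
  simp [sheafEnd, Functor.map_add]

lemma sheafEnd_id (F : Coh X) : sheafEnd (𝟙 ((single X 0).obj F)) = 𝟙 _ := by
  simp [sheafEnd]

lemma sheafEnd_comp_eq_zero {F G : Coh X} {φ : (single X 0).obj F ⟶ (single X 0).obj F}
    {v : F ⟶ G} (h : φ ≫ (single X 0).map v = 0) : sheafEnd φ ≫ v.hom = 0 := by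
  have := (singleCompCohomologyIso X 0).hom.naturality v
  dsimp at this
  rw [sheafEnd, Category.assoc, Category.assoc]
  erw [← this]
  rw [← Functor.map_comp_assoc, h, Functor.map_zero, zero_comp, comp_zero]

lemma comp_sheafEnd_eq_zero {F G : Coh X} {φ : (single X 0).obj G ⟶ (single X 0).obj G}
    {v : F ⟶ G} (h : (single X 0).map v ≫ φ = 0) : v.hom ≫ sheafEnd φ = 0 := by
  have := (singleCompCohomologyIso X 0).inv.naturality v
  dsimp at this
  rw [sheafEnd, ← Category.assoc]
  erw [this]
  rw [Category.assoc, ← Functor.map_comp_assoc, h, Functor.map_zero, zero_comp, comp_zero]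

/-- A direct summand of a coherent sheaf in the derived category vanishes if the corresponding
projector of sheaves does. -/
lemma isZero_of_sheafEnd_eq_zero {F : Coh X} {A : Db X} {i : A ⟶ (single X 0).obj F}
    {p : (single X 0).obj F ⟶ A} (h : i ≫ p = 𝟙 A) (h0 : sheafEnd (p ≫ i) = 0) : IsZero A := by
  have hpi : (cohomology X 0).map (p ≫ i) = 0 := by
    rw [← cancel_epi ((singleCompCohomologyIso X 0).inv.app F),
      ← cancel_mono ((singleCompCohomologyIso X 0).hom.app F)]
    simpa [sheafEnd] using h0
  refine isZero_of_isZero_cohomology fun n ↦ ?_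
  rw [IsZero.iff_id_eq_zero]
  by_cases hn : n = 0
  · subst hn
    have : i ≫ (p ≫ i) ≫ p = 𝟙 A := by simp [h]
    rw [← (cohomology X 0).map_id, ← this, Functor.map_comp, Functor.map_comp, hpi,
      zero_comp, comp_zero]
  · rw [← (cohomology X n).map_id, ← h, Functor.map_comp,
      (isZero_cohomology_single F hn).eq_of_src ((cohomology X n).map p) 0, comp_zero]

variable {I₁ I₂ : ObjectProperty (Db X)} [I₁.IsTriangulated] [I₁.IsClosedUnderIsomorphisms]

/-- On a connected scheme, the structure sheaf lies in one of the two summands of an orthogonal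
decomposition. -/
lemma structureModule_mem_or_mem [ConnectedSpace X] [I₂.IsClosedUnderIsomorphisms]
    (h₁₂ : IsSemiorthogonalDecomposition I₁ I₂) (h₂₁ : IsSemiorthogonalDecomposition I₂ I₁) :
    I₁ ((single X 0).obj ⟨_, isCoherent_structureModule X⟩) ∨
      I₂ ((single X 0).obj ⟨_, isCoherent_structureModule X⟩) := by
  obtain ⟨C₁, C₂, i₁, p₁, i₂, p₂, hC₁, hC₂, e₁, e₂, total⟩ := h₁₂.exists_splitting h₂₁
    ((single X 0).obj ⟨_, isCoherent_structureModule X⟩)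
  have hidem : sheafEnd (p₁ ≫ i₁) ≫ sheafEnd (p₁ ≫ i₁) = sheafEnd (p₁ ≫ i₁) := by
    rw [← sheafEnd_comp, Category.assoc, reassoc_of% e₁]
  rcases structureModule.eq_zero_or_eq_id hidem with h | h
  · have hz : i₁ = 0 := (isZero_of_sheafEnd_eq_zero e₁ h).eq_of_src _ _
    rw [hz, comp_zero, zero_add] at total
    exact Or.inr (I₂.prop_of_iso ⟨i₂, p₂, e₂, total⟩ hC₂)
  · have hs := congr(sheafEnd $total)
    rw [sheafEnd_add, h, sheafEnd_id] at hs
    have hz : i₂ = 0 := (isZero_of_sheafEnd_eq_zero e₂ (by simpa using hs)).eq_of_src _ _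
    rw [hz, comp_zero, add_zero] at total
    exact Or.inl (I₁.prop_of_iso ⟨i₁, p₁, e₁, total⟩ hC₁)

/-- If the projector of a coherent sheaf to its summand in `I₂` vanishes on the level of sheaves,
then the sheaf lies in `I₁`. -/
lemma single_mem_of_forall (h₁₂ : IsSemiorthogonalDecomposition I₁ I₂)
    (h₂₁ : IsSemiorthogonalDecomposition I₂ I₁) (F : Coh X)
    (hF : ∀ (C₂ : Db X) (i₂ : C₂ ⟶ (single X 0).obj F) (p₂ : (single X 0).obj F ⟶ C₂), I₂ C₂ →
      i₂ ≫ p₂ = 𝟙 _ → sheafEnd (p₂ ≫ i₂) = 0) : I₁ ((single X 0).obj F) := by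
  obtain ⟨C₁, C₂, i₁, p₁, i₂, p₂, hC₁, hC₂, e₁, e₂, total⟩ := h₁₂.exists_splitting h₂₁
    ((single X 0).obj F)
  have hz : i₂ = 0 := (isZero_of_sheafEnd_eq_zero e₂ (hF _ _ _ hC₂ e₂)).eq_of_src _ _
  rw [hz, comp_zero, add_zero] at total
  exact I₁.prop_of_iso ⟨i₁, p₁, e₁, total⟩ hC₁

/-- Once the structure sheaf lies in `I₁`, so do the skyscraper sheaves, which are quotients of
it. -/
lemma skyscraperModule_mem [JacobsonSpace X] (h₁₂ : IsSemiorthogonalDecomposition I₁ I₂)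
    (h₂₁ : IsSemiorthogonalDecomposition I₂ I₁)
    (hO : I₁ ((single X 0).obj ⟨_, isCoherent_structureModule X⟩))
    {U : X.Opens} (hU : IsAffineOpen U) (m : Ideal Γ(X, U)) [m.IsMaximal] :
    I₁ ((single X 0).obj ⟨_, isCoherent_skyscraperModule hU m⟩) := by
  refine single_mem_of_forall h₁₂ h₂₁ _ fun C₂ i₂ p₂ hC₂ e₂ ↦ ?_
  let v : (⟨_, isCoherent_structureModule X⟩ : Coh X) ⟶ ⟨_, isCoherent_skyscraperModule hU m⟩ :=
    ObjectProperty.homMk (toSkyscraperModule hU m)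
  have horth : (single X 0).map v ≫ p₂ = 0 := by
    have := h₂₁.eq_rightOrthogonal ▸ hC₂
    exact this _ hO
  exact eq_zero_of_toSkyscraperModule_comp hU m
    (comp_sheafEnd_eq_zero (v := v) (by rw [reassoc_of% horth, zero_comp]))

/-- Once the skyscraper sheaves lie in `I₁`, so do all coherent sheaves, since a nonzero summand
in `I₂` would have a nonzero morphism to a skyscraper sheaf. -/
lemma single_mem [JacobsonSpace X] (h₁₂ : IsSemiorthogonalDecomposition I₁ I₂)
    (h₂₁ : IsSemiorthogonalDecomposition I₂ I₁)
    (hO : I₁ ((single X 0).obj ⟨_, isCoherent_structureModule X⟩)) (F : Coh X) :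
    I₁ ((single X 0).obj F) := by
  refine single_mem_of_forall h₁₂ h₂₁ _ fun C₂ i₂ p₂ hC₂ e₂ ↦ ?_
  by_contra hne
  have hidem : sheafEnd (p₂ ≫ i₂) ≫ sheafEnd (p₂ ≫ i₂) = sheafEnd (p₂ ≫ i₂) := by
    rw [← sheafEnd_comp, Category.assoc, reassoc_of% e₂]
  obtain ⟨U, hU, m, _, v, hv⟩ := exists_skyscraperModule_comp_ne_zero F.property hidem hne
  let v' : F ⟶ ⟨_, isCoherent_skyscraperModule hU m⟩ := ObjectProperty.homMk v
  have horth : i₂ ≫ (single X 0).map v' = 0 := by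
    have := h₁₂.eq_rightOrthogonal ▸ skyscraperModule_mem h₁₂ h₂₁ hO hU m
    exact this _ hC₂
  exact hv (sheafEnd_comp_eq_zero (v := v') (by rw [Category.assoc, horth, comp_zero]))

/-- If the structure sheaf lies in `I₁`, then `I₂ = 0`. -/
lemma isZero_of_structureModule_mem [JacobsonSpace X]
    (h₁₂ : IsSemiorthogonalDecomposition I₁ I₂) (h₂₁ : IsSemiorthogonalDecomposition I₂ I₁)
    (hO : I₁ ((single X 0).obj ⟨_, isCoherent_structureModule X⟩)) (C : Db X) (hC : I₂ C) :
    IsZero C := by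
  have hC₁ : I₁ C := devissage I₁ (single_mem h₁₂ h₂₁ hO) C
  rw [h₁₂.eq_rightOrthogonal] at hC₁
  exact (IsZero.iff_id_eq_zero C).2 (hC₁ (𝟙 C) hC)

end Db

/-! ### Closed points of quasi-projective schemes -/

section

attribute [local instance] MvPolynomial.gradedAlgebra

/-- Projective space is locally of finite type over `ℂ`, the degree zero part of the homogeneous
coordinate ring being `ℂ`. -/
instance (n : ℕ) : LocallyOfFiniteType (ProjectiveSpaceC.toSpec n) := by
  let 𝒜 := MvPolynomial.homogeneousSubmodule (Fin (n + 1)) ℂ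
  have : IsScalarTower ℂ (𝒜 0) (MvPolynomial (Fin (n + 1)) ℂ) :=
    ⟨fun c x p ↦ smul_mul_assoc c (x : MvPolynomial (Fin (n + 1)) ℂ) p⟩
  have : Algebra.FiniteType (𝒜 0) (MvPolynomial (Fin (n + 1)) ℂ) :=
    .of_restrictScalars_finiteType ℂ _ _
  have h₁ : LocallyOfFiniteType (Proj.toSpecZero 𝒜) := inferInstance
  have hsurj : Function.Surjective (algebraMap ℂ (𝒜 0)) := by
    rintro ⟨p, hp⟩
    have hp' : p ∈ (1 : Submodule ℂ (MvPolynomial (Fin (n + 1)) ℂ)) := by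
      rwa [← MvPolynomial.homogeneousSubmodule_zero]
    obtain ⟨c, hc⟩ := Submodule.mem_one.1 hp'
    exact ⟨c, Subtype.ext hc⟩
  have : IsClosedImmersion (Spec.map (CommRingCat.ofHom (algebraMap ℂ (𝒜 0)))) :=
    .spec_of_surjective _ hsurj
  exact inferInstanceAs (LocallyOfFiniteType (Proj.toSpecZero 𝒜 ≫ Spec.map _))

end

lemma IsQuasiProjective.jacobsonSpace {X : Scheme.{0}} {f : X ⟶ Spec (.of ℂ)}
    (hf : IsQuasiProjective f) : JacobsonSpace X := by
  obtain ⟨n, i, _, rfl⟩ := hf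
  have : LocallyOfFiniteType (i ≫ ProjectiveSpaceC.toSpec n) := inferInstance
  exact LocallyOfFiniteType.jacobsonSpace (i ≫ ProjectiveSpaceC.toSpec n)

end Decomposition

end

theorem mainTheorem11 (X : Scheme.{0}) (f : X ⟶ Spec (.of ℂ)) (hf : IsQuasiProjective f)
    [ConnectedSpace X] (I₁ I₂ : ObjectProperty (Db X))
    [I₁.IsTriangulated] [I₁.IsStableUnderRetracts]
    [I₂.IsTriangulated] [I₂.IsStableUnderRetracts]
    (h₁₂ : IsSemiorthogonalDecomposition I₁ I₂)
    (h₂₁ : IsSemiorthogonalDecomposition I₂ I₁) :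
    (∀ C : Db X, I₁ C → IsZero C) ∨ (∀ C : Db X, I₂ C → IsZero C) := by
  have := hf.jacobsonSpace
  rcases Db.structureModule_mem_or_mem h₁₂ h₂₁ with h | h
  · exact Or.inr (Db.isZero_of_structureModule_mem h₁₂ h₂₁ h)
  · exact Or.inl (Db.isZero_of_structureModule_mem h₂₁ h₁₂ h)
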